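/- Let $X$ be a complex Banach space, $L(X)$ the Banach algebra of bounded linear operators on $X$, $K(X)$ the ideal of compact operators, and $\Pi : L(X) \to \mathcal{C}(X) = L(X)/K(X)$ the projection onto the Calkin algebra. An element $a$ of a unital ring is *quasinilpotent* if $1 - xa$ is invertible for every $x$ commuting with $a$. For $T \in L(X)$, an idempotent $P = P^2 \in L(X)$ is *associated to $T$ in $\mathcal{C}(X)$* if $\Pi(P)$ commutes with $\Pi(T)$, $\Pi(P)\Pi(T)$ is quasinilpotent in $\mathcal{C}(X)$, and $\Pi(T) + \Pi(P)$ is invertible in $\mathcal{C}(X)$. The operator $T$ is *pseudo B-Fredholm* if some idempotent is associated to it in $\mathcal{C}(X)$; in that case its index is $\mathbf{ind}(T) = \mathrm{ind}(T+P)$, the Fredholm index $\dim N(T+P) - \operatorname{codim} R(T+P)$ of the Fredholm operator $T + P$, for any associated idempotent $P$ (the value does not depend on $P$). An operator $R$ on a Banach space is *Riesz* if $R - \lambda I$ is Fredholm for every $\lambda \in \mathbb{C} \setminus \{0\}$. Given an idempotent $P \in L(X)$, put $X_1 = R(P)$ and $X_2 = N(P) = R(I-P)$, with the norm of $X$, and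 for $S \in L(X)$ put $S_1 = (PSP)|_{X_1} \in L(X_1)$ and $S_2 = ((I-P)S(I-P))|_{X_2} \in L(X_2)$. **Theorem.** Let $T \in L(X)$ be a pseudo B-Fredholm operator and let $P \in L(X)$ be an idempotent associated to $T$ in $\mathcal{C}(X)$. Then there exists $\varepsilon > 0$ such that, whenever $U \in L(X)$ satisfies 1. $\Pi(P)$ commutes with $\Pi(U)$, 2. $U_1$ is a Riesz operator and the commutator $[T_1, U_1] = T_1U_1 - U_1T_1$ is compact, 3. $\|U_2\| < \varepsilon$, the operator $T + U$ is pseudo B-Fredholm and $\mathbf{ind}(T+U) = \mathbf{ind}(T)$ (in particular, both indices are well defined). -/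

import Mathlib

noncomputable section

namespace PseudoBFredholm

/-- The two-sided ideal `K(X)` of compact operators in `L(X)`. -/
def compactIdeal (X : Type*) [NormedAddCommGroup X] [NormedSpace ℂ X] : Ideal (X →L[ℂ] X) where
  carrier := {K | IsCompactOperator K}
  add_mem' := fun hK hL => hK.add hL
  zero_mem' := isCompactOperator_zero
  smul_mem' := fun S _ hK => hK.clm_comp S

instance (X : Type*) [NormedAddCommGroup X] [NormedSpace ℂ X] : (compactIdeal X).IsTwoSided :=
  ⟨fun S hK => IsCompactOperator.comp_clm hK S⟩

/-- The Calkin algebra `C(X) = L(X) / K(X)`. -/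
abbrev Calkin (X : Type*) [NormedAddCommGroup X] [NormedSpace ℂ X] : Type _ :=
  (X →L[ℂ] X) ⧸ compactIdeal X

/-- The natural projection `Π : L(X) → C(X)`. -/
abbrev toCalkin (X : Type*) [NormedAddCommGroup X] [NormedSpace ℂ X] :
    (X →L[ℂ] X) →+* Calkin X :=
  Ideal.Quotient.mk (compactIdeal X)

/-- An element `a` of a unital ring is quasinilpotent if `1 - x a` is invertible for every `x`
commuting with `a`. In a complex Banach algebra this is the same as having spectral radius zero. -/
def IsQuasinilpotent {A : Type*} [Ring A] (a : A) : Prop :=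
  ∀ x : A, Commute x a → IsUnit (1 - x * a)

/-- The idempotent operator `P` is associated to `T` in the Calkin algebra: `Π(P)` commutes with
`Π(T)`, the product `Π(P)Π(T)` is quasinilpotent and `Π(T) + Π(P)` is invertible. -/
structure IsAssociated {X : Type*} [NormedAddCommGroup X] [NormedSpace ℂ X]
    (P T : X →L[ℂ] X) : Prop where
  isIdempotentElem : IsIdempotentElem P
  commute : Commute (toCalkin X P) (toCalkin X T)
  isQuasinilpotent : IsQuasinilpotent (toCalkin X P * toCalkin X T)
  isUnit : IsUnit (toCalkin X T + toCalkin X P)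

/-- `T` is pseudo B-Fredholm: `Π(T)` is generalized Drazin invertible in the Calkin algebra. -/
def IsPseudoBFredholm {X : Type*} [NormedAddCommGroup X] [NormedSpace ℂ X]
    (T : X →L[ℂ] X) : Prop :=
  ∃ P : X →L[ℂ] X, IsAssociated P T

/-- `T` is pseudo B-Fredholm and its index, i.e. the index `dim ker - codim range` of the Fredholm
operator `T + P`, is `n` whichever idempotent `P` associated to `T` is used to compute it. -/
def HasIndex {X : Type*} [NormedAddCommGroup X] [NormedSpace ℂ X]
    (T : X →L[ℂ] X) (n : ℤ) : Prop :=
  IsPseudoBFredholm T ∧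
    ∀ P : X →L[ℂ] X, IsAssociated P T →
      (T + P).IsFredholm ∧ (T + P).toLinearMap.index = n

/-- `T` is a Riesz operator: `T - λ I` is Fredholm for every nonzero complex `λ`. -/
def IsRiesz {X : Type*} [NormedAddCommGroup X] [NormedSpace ℂ X] (T : X →L[ℂ] X) : Prop :=
  ∀ z : ℂ, z ≠ 0 → (T - z • (1 : X →L[ℂ] X)).IsFredholm

/-- The compression `(P T P)|_{R(P)} : R(P) → R(P)`. For an idempotent `P`, `compression P T` is
`T₁`, acting on `X₁ = R(P)`, and `compression (1 - P) T` is `T₂`, acting on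
`X₂ = R(I - P) = N(P)`. The range carries the norm of `X`. -/
def compression {X : Type*} [NormedAddCommGroup X] [NormedSpace ℂ X] (P T : X →L[ℂ] X) :
    P.range →L[ℂ] P.range :=
  (P * T * P).restrict fun x _ => ⟨T (P x), rfl⟩

end PseudoBFredholm

end

/-! Write p, t, u for the images of P, T, U in the Calkin algebra. There p splits t into a
quasinilpotent part pt and a part (1 - p)t that is invertible on the complementary corner. The Riesz
hypothesis makes pu quasinilpotent, and it commutes with pt because [T₁, U₁] is compact, so p(t + u)
is again quasinilpotent. For small U₂, (1 - p)(t + u) remains invertible on its corner. Hence the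
same P is associated to T + U (`IsSpectralIdempotent.add`, `IsAssociated.exists_forall_add`).

The hypotheses on U pass to sU for s in [0, 1], so T + P + sU is a path of Fredholm operators and
its index is constant (`index_add_eq_of_segment`). The index does not depend on P: the spectral
idempotent is unique in the Calkin algebra (`IsSpectralIdempotent.unique`), and compact
perturbations preserve the index (`index_eq_of_toCalkin_eq`). -/

noncomputable section

namespace PseudoBFredholm

open Filter Topology

/-! ### Quasinilpotents and spectral idempotents in Banach algebras. -/

section BanachAlgebra

variable {A : Type*} [NormedRing A] [NormedAlgebra ℂ A] [CompleteSpace A]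

/-- An element whose spectrum is contained in `{0}` has powers decaying faster than any
geometric sequence. -/
theorem tendsto_pow_mul_norm_pow {a : A} (h : ∀ z : ℂ, IsUnit (1 - z • a)) {C : ℝ} (hC : 0 ≤ C) :
    Tendsto (fun n : ℕ => C ^ n * ‖a ^ n‖) atTop (𝓝 0) := by
  have hr : spectralRadius ℂ a = 0 := by
    refine le_antisymm (iSup₂_le fun z hz => ?_) bot_le
    by_contra hne
    have hz0 : z ≠ 0 := by rintro rfl; simp at hne
    refine hz ?_
    have : algebraMap ℂ A z - a = z • (1 - z⁻¹ • a) := by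
      rw [smul_sub, smul_smul, mul_inv_cancel₀ hz0, one_smul, Algebra.algebraMap_eq_smul_one]
    rw [spectrum.mem_resolventSet_iff, this]
    exact (h z⁻¹).smul (Units.mk0 z hz0)
  have hg := spectrum.pow_nnnorm_pow_one_div_tendsto_nhds_spectralRadius a
  rw [hr] at hg
  -- Chosen so that C * δ ≤ 1/2; the summand 1 avoids dividing by zero when C = 0.
  set δ : NNReal := ⟨1 / (2 * (C + 1)), by positivity⟩ with hδ
  have hδ0 : (0 : ENNReal) < δ := by
    rw [ENNReal.coe_pos, ← NNReal.coe_pos]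
    change 0 < 1 / (2 * (C + 1))
    positivity
  have hev := hg.eventually_lt_const hδ0
  have hbound : ∀ᶠ n : ℕ in atTop, C ^ n * ‖a ^ n‖ ≤ (1 / 2 : ℝ) ^ n := by
    filter_upwards [hev, eventually_gt_atTop 0] with n hn hn0
    have h1 : (‖a ^ n‖₊ : ENNReal) ≤ (δ : ENNReal) ^ n := by
      have h2 := ENNReal.rpow_le_rpow hn.le (z := (n : ℝ)) (by positivity)
      rwa [← ENNReal.rpow_mul, one_div, inv_mul_cancel₀ (by positivity), ENNReal.rpow_one,
        ENNReal.rpow_natCast] at h2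
    have h3 : ‖a ^ n‖ ≤ (1 / (2 * (C + 1))) ^ n := by
      rw [← ENNReal.coe_pow, ENNReal.coe_le_coe] at h1
      exact_mod_cast h1
    calc C ^ n * ‖a ^ n‖ ≤ C ^ n * (1 / (2 * (C + 1))) ^ n := by gcongr
      _ = (C * (1 / (2 * (C + 1)))) ^ n := (mul_pow _ _ _).symm
      _ ≤ (1 / 2) ^ n := by
        gcongr
        rw [mul_one_div, div_le_div_iff₀ (by positivity) (by norm_num)]
        linarith
  refine squeeze_zero' (Eventually.of_forall fun n => by positivity) hbound ?_
  exact tendsto_pow_atTop_nhds_zero_of_lt_one (by norm_num) (by norm_num)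

theorem isUnit_one_sub_of_isUnit_one_sub_pow {R : Type*} [Ring R] {y : R} {n : ℕ}
    (h : IsUnit (1 - y ^ n)) : IsUnit (1 - y) := by
  have hc : Commute (1 - y) (∑ i ∈ Finset.range n, y ^ i) :=
    Commute.sum_right _ _ _ fun i _ =>
      (Commute.one_left _).sub_left ((Commute.refl y).pow_right i)
  have hm : (1 - y) * (∑ i ∈ Finset.range n, y ^ i) = 1 - y ^ n := mul_neg_geom_sum y n
  rw [← hm] at h
  exact (hc.isUnit_mul_iff.1 h).1

/-- Scalars suffice: if x commutes with a, then (xa)ⁿ = xⁿaⁿ tends to 0, so 1 - (xa)ⁿ is invertible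
for some n, and 1 - xa is a commuting factor of it. -/
theorem isQuasinilpotent_of_isUnit_one_sub_smul {a : A} (h : ∀ z : ℂ, IsUnit (1 - z • a)) :
    IsQuasinilpotent a := by
  intro x hx
  have ht := tendsto_pow_mul_norm_pow h (norm_nonneg x)
  obtain ⟨n, hn, hn0⟩ := ((ht.eventually_lt_const one_pos).and (eventually_gt_atTop 0)).exists
  refine isUnit_one_sub_of_isUnit_one_sub_pow (n := n) ?_
  refine isUnit_one_sub_of_norm_lt_one ?_
  calc ‖(x * a) ^ n‖ = ‖x ^ n * a ^ n‖ := by rw [hx.mul_pow]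
    _ ≤ ‖x ^ n‖ * ‖a ^ n‖ := norm_mul_le _ _
    _ ≤ ‖x‖ ^ n * ‖a ^ n‖ := by gcongr; exact norm_pow_le' x hn0
    _ < 1 := hn

theorem IsQuasinilpotent.isUnit_one_sub_smul {R : Type*} [Ring R] [Algebra ℂ R] {a : R}
    (h : IsQuasinilpotent a) (z : ℂ) : IsUnit (1 - z • a) := by
  have := h (algebraMap ℂ R z) (Algebra.commutes z a)
  rwa [← Algebra.smul_def] at this

/-- With u = 1 - za, which commutes with b, one has 1 - z(a + b) = u(1 - z u⁻¹ b). -/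
theorem IsQuasinilpotent.add {a b : A} (ha : IsQuasinilpotent a) (hb : IsQuasinilpotent b)
    (hab : Commute a b) : IsQuasinilpotent (a + b) := by
  refine isQuasinilpotent_of_isUnit_one_sub_smul fun z => ?_
  obtain ⟨u, hu⟩ := ha.isUnit_one_sub_smul z
  have hcu : Commute (u : A) b := by
    rw [hu]
    exact (Commute.one_left _).sub_left (hab.smul_left z)
  have h1 := hb (z • (↑u⁻¹ : A)) (hcu.units_inv_left.smul_left z)
  have : 1 - z • (a + b) = u * (1 - z • (↑u⁻¹ : A) * b) := by
    rw [mul_sub, smul_mul_assoc, mul_smul_comm, Units.mul_inv_cancel_left, mul_one, hu, smul_add,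
      sub_sub]
  rw [this]
  exact u.isUnit.mul h1

theorem IsQuasinilpotent.smul {R : Type*} [Ring R] [Algebra ℂ R] {a : R}
    (ha : IsQuasinilpotent a) (z : ℂ) : IsQuasinilpotent (z • a) := by
  intro x hx
  by_cases hz : z = 0
  · simp [hz]
  rw [mul_smul_comm, ← smul_mul_assoc]
  refine ha _ (Commute.smul_left ?_ z)
  simpa [smul_smul, inv_mul_cancel₀ hz] using hx.smul_right z⁻¹

/-- `p` is a spectral idempotent of `t` at `0`. -/
structure IsSpectralIdempotent {R : Type*} [Ring R] (p t : R) : Prop where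
  isIdempotentElem : IsIdempotentElem p
  commute : Commute p t
  isQuasinilpotent : IsQuasinilpotent (p * t)
  isUnit : IsUnit (t + p)

/-- With `p` a spectral idempotent of `t`, the complementary part `(1 - p) t + p` is invertible. -/
theorem IsSpectralIdempotent.isUnit_one_sub_mul_add {R : Type*} [Ring R] {p t : R}
    (h : IsSpectralIdempotent p t) : IsUnit ((1 - p) * t + p) := by
  obtain ⟨s, hs⟩ := h.isUnit
  have hp : p * p = p := h.isIdempotentElem
  have hpt : p * t = t * p := h.commute
  have hc : Commute (s : R) p := by rw [hs]; exact h.commute.symm.add_left (Commute.refl p)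
  have hc' : (↑s⁻¹ : R) * p = p * ↑s⁻¹ := hc.units_inv_left
  have hq : (1 - p) * p = 0 := by rw [sub_mul, one_mul, hp, sub_self]
  have hq' : p * (1 - p) = 0 := by rw [mul_sub, mul_one, hp, sub_self]
  have hqu : (1 - p) * s = s * (1 - p) := ((Commute.one_left _).sub_left hc.symm).eq
  have hqs : (1 - p) * ↑s⁻¹ = ↑s⁻¹ * (1 - p) := by rw [sub_mul, mul_sub, hc', one_mul, mul_one]
  have hqq : (1 - p) * (1 - p) = 1 - p := h.isIdempotentElem.one_sub
  have e1 : (1 - p) * t = (1 - p) * s := by rw [hs, mul_add, hq, add_zero]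
  have h1 : (1 - p) * s * ((1 - p) * ↑s⁻¹) = 1 - p := by
    rw [hqs, mul_assoc, s.mul_inv_cancel_left, hqq]
  have h2 : (1 - p) * s * p = 0 := by rw [hqu, mul_assoc, hq, mul_zero]
  have h3 : p * ((1 - p) * ↑s⁻¹) = 0 := by rw [← mul_assoc, hq', zero_mul]
  have h4 : (1 - p) * ↑s⁻¹ * ((1 - p) * s) = 1 - p := by
    rw [hqu, mul_assoc, s.inv_mul_cancel_left, hqq]
  have h5 : (1 - p) * ↑s⁻¹ * p = 0 := by rw [hqs, mul_assoc, hq, mul_zero]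
  have h6 : p * ((1 - p) * s) = 0 := by rw [← mul_assoc, hq', zero_mul]
  -- On the corner of 1 - p the element agrees with s = t + p, so s⁻¹ inverts it there; on the
  -- corner of p it is the identity.
  refine ⟨⟨(1 - p) * t + p, (1 - p) * ↑s⁻¹ + p, ?_, ?_⟩, rfl⟩
  · rw [e1, add_mul, mul_add, mul_add, h1, h2, h3, hp, add_zero, zero_add, sub_add_cancel]
  · rw [e1, add_mul, mul_add, mul_add, h4, h5, h6, hp, add_zero, zero_add, sub_add_cancel]

/-- Here c is the generalized Drazin inverse of t; it gives 1 - p = tⁿcⁿ for all n > 0, as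
uniqueness requires. -/
theorem IsSpectralIdempotent.exists_inverse {R : Type*} [Ring R] {p t : R}
    (h : IsSpectralIdempotent p t) : ∃ c : R, c * t = t * c ∧ t * c = 1 - p := by
  obtain ⟨w, hw⟩ := h.isUnit_one_sub_mul_add
  have hp : p * p = p := h.isIdempotentElem
  have hpt : p * t = t * p := h.commute
  have hwp : (w : R) * p = p := by
    rw [hw, add_mul, mul_assoc, ← hpt, ← mul_assoc, sub_mul, one_mul, hp, sub_self, zero_mul,
      zero_add]
  have hpw : p * w = p := by
    rw [hw, mul_add, ← mul_assoc, mul_sub, mul_one, hp, sub_self, zero_mul, zero_add]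
  have hwt : (w : R) * t = t * w := by
    rw [hw, add_mul, mul_add, hpt, mul_assoc, sub_mul, sub_mul, mul_sub, one_mul, one_mul,
      ← mul_assoc p, ← mul_assoc t p, hpt]
  have hq : (w : R) * (1 - p) = t * (1 - p) := by
    rw [mul_sub, mul_one, hwp, hw, add_sub_cancel_right, sub_mul, one_mul, hpt, mul_sub, mul_one]
  have hcp : Commute (w : R) p := by rw [Commute, SemiconjBy, hwp, hpw]
  have hi : (↑w⁻¹ : R) * t = t * ↑w⁻¹ := (show Commute (w : R) t from hwt).units_inv_left
  have hip : (↑w⁻¹ : R) * (1 - p) = (1 - p) * ↑w⁻¹ :=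
    ((Commute.one_right _).sub_right hcp).units_inv_left
  have htc : t * (↑w⁻¹ * (1 - p)) = 1 - p := by
    rw [← mul_assoc, ← hi, mul_assoc, ← hq, Units.inv_mul_cancel_left]
  refine ⟨↑w⁻¹ * (1 - p), ?_, htc⟩
  have hqt : (1 - p) * t = t * (1 - p) := by rw [sub_mul, mul_sub, hpt, one_mul, mul_one]
  rw [mul_assoc, hqt, ← mul_assoc, hi, mul_assoc]

/-- For every n > 0, p(1 - q) = p tⁿcⁿ = (pt)ⁿcⁿ, which tends to 0 since pt is quasinilpotent;
symmetrically for (1 - q)p. -/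
theorem IsSpectralIdempotent.mul_eq {p q t : A} (hp : IsSpectralIdempotent p t)
    (hq : IsSpectralIdempotent q t) : p * q = p ∧ q * p = p := by
  obtain ⟨c, hct, htc⟩ := hq.exists_inverse
  have hcomm : Commute t c := hct.symm
  have hqq : IsIdempotentElem (1 - q) := hq.isIdempotentElem.one_sub
  have hlim := tendsto_pow_mul_norm_pow hp.isQuasinilpotent.isUnit_one_sub_smul (norm_nonneg c)
  have key : ∀ n : ℕ, 0 < n → ‖p * (1 - q)‖ ≤ ‖c‖ ^ n * ‖(p * t) ^ n‖ ∧
      ‖(1 - q) * p‖ ≤ ‖c‖ ^ n * ‖(p * t) ^ n‖ := by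
    intro n hn
    have hpn : p ^ n = p := hp.isIdempotentElem.pow_eq hn.ne'
    have e1 : 1 - q = t ^ n * c ^ n := by rw [← hcomm.mul_pow, htc, hqq.pow_eq hn.ne']
    have e2 : p * t ^ n = (p * t) ^ n := by rw [hp.commute.mul_pow, hpn]
    constructor
    · rw [e1, ← mul_assoc, e2, mul_comm (‖c‖ ^ n)]
      exact (norm_mul_le _ _).trans (by gcongr; exact norm_pow_le' c hn)
    · rw [e1, (hcomm.pow_pow n n).eq, mul_assoc, ← (hp.commute.pow_right n).eq, e2]
      exact (norm_mul_le _ _).trans (by gcongr; exact norm_pow_le' c hn)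
  have hev := eventually_gt_atTop (0 : ℕ)
  have z1 : p * (1 - q) = 0 := norm_le_zero_iff.1 <|
    ge_of_tendsto hlim (hev.mono fun n hn => (key n hn).1)
  have z2 : (1 - q) * p = 0 := norm_le_zero_iff.1 <|
    ge_of_tendsto hlim (hev.mono fun n hn => (key n hn).2)
  rw [mul_sub, mul_one, sub_eq_zero] at z1
  rw [sub_mul, one_mul, sub_eq_zero] at z2
  exact ⟨z1.symm, z2.symm⟩

/-- The spectral idempotent at `0` is unique. -/
theorem IsSpectralIdempotent.unique {p q t : A} (hp : IsSpectralIdempotent p t)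
    (hq : IsSpectralIdempotent q t) : p = q := by
  rw [← (hp.mul_eq hq).1, (hq.mul_eq hp).2]

end BanachAlgebra

/-! ### The Calkin algebra as a Banach algebra. -/

section Calkin

variable (X : Type*) [NormedAddCommGroup X] [NormedSpace ℂ X]

instance isClosed_compactIdeal [CompleteSpace X] :
    IsClosed (compactIdeal X : Set (X →L[ℂ] X)) :=
  isClosed_setOfPred_isCompactOperator

instance calkinNormedRing [CompleteSpace X] : NormedRing (Calkin X) where
  __ := (inferInstance : Ring (Calkin X))
  __ := (inferInstance : NormedAddCommGroup (Calkin X))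
  -- Lift both classes with norm loss at most ε, multiply the lifts, and let ε tend to 0.
  norm_mul_le a b := by
    refine le_of_tendsto_of_tendsto (f := fun _ : ℝ => ‖a * b‖)
      (g := fun ε : ℝ => (‖a‖ + ε) * (‖b‖ + ε)) (b := 𝓝[>] 0) tendsto_const_nhds ?_ ?_
    · have : Tendsto (fun ε : ℝ => (‖a‖ + ε) * (‖b‖ + ε)) (𝓝 0) (𝓝 ((‖a‖ + 0) * (‖b‖ + 0))) :=
        Continuous.tendsto (by fun_prop) 0
      rw [add_zero, add_zero] at this
      exact this.mono_left nhdsWithin_le_nhds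
    · filter_upwards [self_mem_nhdsWithin] with ε hε
      obtain ⟨S, rfl, hS⟩ := Submodule.Quotient.norm_mk_lt a hε
      obtain ⟨R, rfl, hR⟩ := Submodule.Quotient.norm_mk_lt b hε
      calc _ ≤ ‖S * R‖ := Submodule.Quotient.norm_mk_le (compactIdeal X) (S * R)
        _ ≤ ‖S‖ * ‖R‖ := norm_mul_le _ _
        _ ≤ _ := by
          have := (norm_nonneg S).trans hS.le
          gcongr

instance calkinNormedAlgebra [CompleteSpace X] : NormedAlgebra ℂ (Calkin X) where
  __ := (inferInstance : Algebra ℂ (Calkin X))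
  norm_smul_le z a := norm_smul_le z a

variable {X}

theorem toCalkin_eq_zero_iff {S : X →L[ℂ] X} : toCalkin X S = 0 ↔ IsCompactOperator S :=
  Ideal.Quotient.eq_zero_iff_mem

theorem toCalkin_eq_iff {S R : X →L[ℂ] X} :
    toCalkin X S = toCalkin X R ↔ IsCompactOperator (S - R) :=
  Ideal.Quotient.eq

theorem toCalkin_smul (z : ℂ) (S : X →L[ℂ] X) : toCalkin X (z • S) = z • toCalkin X S := rfl

theorem IsAssociated.isSpectralIdempotent {P T : X →L[ℂ] X} (h : IsAssociated P T) :
    IsSpectralIdempotent (toCalkin X P) (toCalkin X T) :=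
  ⟨h.isIdempotentElem.map _, h.commute, h.isQuasinilpotent, h.isUnit⟩

end Calkin

/-! ### Riesz theory for compact perturbations of the identity. -/

section Fredholm

variable {X : Type*} [NormedAddCommGroup X] [NormedSpace ℂ X]

theorem isCompactOperator_of_finiteDimensional_comp {N : Submodule ℂ X} [FiniteDimensional ℂ N]
    (φ : N →ₗ[ℂ] X) (π : X →L[ℂ] N) :
    IsCompactOperator (LinearMap.toContinuousLinearMap φ ∘L π) :=
  have := FiniteDimensional.proper ℂ N
  have hπ : IsCompactOperator π := isCompactOperator_of_locallyCompactSpace_dom π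
  hπ.clm_comp (LinearMap.toContinuousLinearMap φ)

/-- On the kernel K acts as -1, so the identity of the kernel is compact. -/
theorem finiteDimensional_ker_one_add {K : X →L[ℂ] X} (hK : IsCompactOperator K) :
    FiniteDimensional ℂ (1 + K).ker := by
  set N := (1 + K).ker
  have hN : ∀ x ∈ N, K x = -x := fun x hx => by
    have : x + K x = 0 := hx
    exact (neg_eq_of_add_eq_zero_right this).symm
  have hmaps : ∀ x ∈ N, (K : X →ₗ[ℂ] X) x ∈ N := fun x hx => by
    simpa [hN x hx] using hx
  have hc : IsCompactOperator ((K : X →ₗ[ℂ] X).restrict hmaps) :=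
    IsCompactOperator.restrict (f := (K : X →ₗ[ℂ] X)) hK hmaps (1 + K).isClosed_ker
  refine FiniteDimensional.of_isCompactOperator_id ?_
  have he : (id : N → N) = -⇑((K : X →ₗ[ℂ] X).restrict hmaps) := by
    funext x
    refine Subtype.ext ?_
    simp [hN x x.2]
  rw [he]
  exact hc.neg

variable [CompleteSpace X]

theorem bijective_one_add_of_injective {K : X →L[ℂ] X} (hK : IsCompactOperator K)
    (h : Function.Injective (1 + K : X →L[ℂ] X)) : Function.Bijective (1 + K : X →L[ℂ] X) := by
  rw [← ContinuousLinearMap.isUnit_iff_bijective]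
  rcases IsCompactOperator.hasEigenvalue_or_mem_resolventSet (T := -K) (μ := (1 : ℂ)) hK.neg
    one_ne_zero with he | hr
  · obtain ⟨x, hx⟩ := he.exists_hasEigenvector
    refine absurd (h (a₁ := x) (a₂ := 0) ?_) hx.2
    have := hx.apply_eq_smul
    simp only [ContinuousLinearMap.coe_coe, neg_apply, one_smul] at this
    rw [map_zero]
    change x + K x = 0
    exact neg_eq_iff_add_eq_zero.1 (neg_eq_iff_eq_neg.1 this).symm
  · rw [spectrum.mem_resolventSet_iff] at hr
    simpa using hr

/-- The kernel is complemented, so 1 + K has a bounded right inverse R. Since R = 1 - KR is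
injective, the previous alternative makes it bijective, which forces 1 + K to be injective. -/
theorem bijective_one_add_of_surjective {K : X →L[ℂ] X} (hK : IsCompactOperator K)
    (h : Function.Surjective (1 + K : X →L[ℂ] X)) : Function.Bijective (1 + K : X →L[ℂ] X) := by
  have := finiteDimensional_ker_one_add hK
  obtain ⟨π, hπ⟩ := Submodule.ClosedComplemented.of_finiteDimensional (𝕜 := ℂ) (1 + K).ker
  let Φ : X →L[ℂ] X × (1 + K).ker := (1 + K).prod π
  have hΦi : Φ.ker = ⊥ := by
    refine (Submodule.eq_bot_iff _).2 fun x hx => ?_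
    have h1 : (1 + K : X →L[ℂ] X) x = 0 := congrArg Prod.fst hx
    have h2 : π x = 0 := congrArg Prod.snd hx
    have := hπ ⟨x, h1⟩
    rw [h2] at this
    exact (congrArg Subtype.val this).symm
  have hΦs : Φ.range = ⊤ := by
    refine LinearMap.range_eq_top.2 fun ⟨y, n⟩ => ?_
    obtain ⟨x, hx⟩ := h y
    refine ⟨x - (π x : X) + n, Prod.ext ?_ ?_⟩
    · have h1 : (1 + K : X →L[ℂ] X) (π x : X) = 0 := (π x).2
      have h2 : (1 + K : X →L[ℂ] X) (n : X) = 0 := n.2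
      change (1 + K : X →L[ℂ] X) (x - (π x : X) + n) = y
      rw [map_add, map_sub, h1, h2, hx, sub_zero, add_zero]
    · change π (x - (π x : X) + n) = n
      rw [map_add, map_sub, hπ, hπ, sub_self, zero_add]
  let e := ContinuousLinearEquiv.ofBijective Φ hΦi hΦs
  let R : X →L[ℂ] X := e.symm.toContinuousLinearMap ∘L ContinuousLinearMap.inl ℂ X (1 + K).ker
  have hR : ∀ y, (1 + K : X →L[ℂ] X) (R y) = y := fun y => by
    have : Φ (R y) = (y, 0) := e.apply_symm_apply (y, 0)
    exact congrArg Prod.fst this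
  have hRK : R = 1 + (-(K ∘L R)) := by
    ext y
    have : R y + K (R y) = y := hR y
    simp [← sub_eq_add_neg, eq_sub_iff_add_eq, this]
  have hRc : IsCompactOperator (-(K ∘L R) : X →L[ℂ] X) := (hK.comp_clm R).neg
  have hRi : Function.Injective R := fun y z hyz => by rw [← hR y, hyz, hR z]
  have hRb : Function.Bijective R := by
    rw [hRK] at hRi ⊢
    exact bijective_one_add_of_injective hRc hRi
  refine ⟨fun x y hxy => ?_, h⟩
  obtain ⟨x, rfl⟩ := hRb.2 x
  obtain ⟨y, rfl⟩ := hRb.2 y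
  rw [hR, hR] at hxy
  rw [hxy]

/-- A compact perturbation `1 + K` of the identity becomes invertible after adding an operator
that maps the kernel isomorphically onto a complement of the range. -/
theorem exists_isUnit_one_add_add {K : X →L[ℂ] X} (hK : IsCompactOperator K) :
    (∃ F : X →L[ℂ] X, F.toLinearMap.HasFiniteRange ∧ IsUnit (1 + K + F)) ∧
      (1 + K).toLinearMap.index = 0 := by
  have hfin := finiteDimensional_ker_one_add hK
  obtain ⟨π, hπ⟩ := Submodule.ClosedComplemented.of_finiteDimensional (𝕜 := ℂ) (1 + K).ker
  obtain ⟨C, hC⟩ := Submodule.exists_isCompl (1 + K).range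
  have hsplit : ∀ x, (1 + K : X →L[ℂ] X) (x - (π x : X)) = (1 + K : X →L[ℂ] X) x := fun x => by
    have : (1 + K : X →L[ℂ] X) (π x : X) = 0 := (π x).2
    rw [map_sub, this, sub_zero]
  have hdisj : ∀ x : X, ∀ c ∈ C, (1 + K : X →L[ℂ] X) x = c → c = 0 := fun x c hc hx =>
    Submodule.disjoint_def.1 hC.disjoint c ⟨x, hx⟩ hc
  obtain ⟨φ, hb⟩ : ∃ φ : (1 + K).ker →ₗ[ℂ] C, Function.Bijective
      (1 + (K + LinearMap.toContinuousLinearMap (C.subtype ∘ₗ φ) ∘L π) : X →L[ℂ] X) := by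
    have hcompact : ∀ φ : (1 + K).ker →ₗ[ℂ] C,
        IsCompactOperator (K + LinearMap.toContinuousLinearMap (C.subtype ∘ₗ φ) ∘L π) := fun φ =>
      hK.add (isCompactOperator_of_finiteDimensional_comp (C.subtype ∘ₗ φ) π)
    have happ : ∀ (φ : (1 + K).ker →ₗ[ℂ] C) (x : X),
        (1 + (K + LinearMap.toContinuousLinearMap (C.subtype ∘ₗ φ) ∘L π) : X →L[ℂ] X) x =
          (1 + K : X →L[ℂ] X) x + φ (π x) := fun φ x => (add_assoc _ _ _).symm
    -- C is not yet known to be finite-dimensional. An injective or a surjective φ exists according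
    -- to which rank is smaller, and the matching alternative gives bijectivity either way.
    rcases le_total (Module.rank ℂ (1 + K).ker) (Module.rank ℂ C) with hle | hle
    · obtain ⟨φ, hφ⟩ := rank_le_iff_exists_linearMap.1 hle
      refine ⟨φ, bijective_one_add_of_injective (hcompact φ) ?_⟩
      refine (injective_iff_map_eq_zero _).2 fun x hx => ?_
      rw [happ] at hx
      have h0 : -(φ (π x) : X) = 0 :=
        hdisj x _ (C.neg_mem (φ (π x)).2) (eq_neg_of_add_eq_zero_left hx)
      have h1 : (φ (π x) : X) = 0 := neg_eq_zero.1 h0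
      have h2 : π x = 0 := (map_eq_zero_iff φ hφ).1 (Subtype.ext h1)
      rw [h1, add_zero] at hx
      have h3 := hπ ⟨x, hx⟩
      rw [h2] at h3
      exact (congrArg Subtype.val h3).symm
    · obtain ⟨j, hj⟩ := rank_le_iff_exists_linearMap.1 hle
      obtain ⟨φ, hφ⟩ := j.exists_leftInverse_of_injective (LinearMap.ker_eq_bot.2 hj)
      refine ⟨φ, bijective_one_add_of_surjective (hcompact φ) fun y => ?_⟩
      obtain ⟨_, ⟨x, rfl⟩, c, hc, rfl⟩ :=
        Submodule.mem_sup.1 (hC.sup_eq_top ▸ Submodule.mem_top : y ∈ (1 + K).range ⊔ C)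
      have hjc : (1 + K : X →L[ℂ] X) (j ⟨c, hc⟩ : X) = 0 := (j ⟨c, hc⟩).2
      refine ⟨x - (π x : X) + j ⟨c, hc⟩, ?_⟩
      rw [happ, map_add, hsplit, hjc, add_zero, map_add, map_sub, hπ, hπ, sub_self, zero_add]
      have : φ (j ⟨c, hc⟩) = ⟨c, hc⟩ := LinearMap.congr_fun hφ ⟨c, hc⟩
      rw [this]
      rfl
  have happ : ∀ x : X, (1 + (K + LinearMap.toContinuousLinearMap (C.subtype ∘ₗ φ) ∘L π) : X →L[ℂ] X) x =
      (1 + K : X →L[ℂ] X) x + φ (π x) := fun x => (add_assoc _ _ _).symm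
  -- Bijectivity of the corrected operator passes to φ, so kernel and cokernel have equal dimension.
  have hφ : Function.Bijective φ := by
    refine ⟨(injective_iff_map_eq_zero _).2 fun n hn => ?_, fun c => ?_⟩
    · refine Subtype.ext (hb.1 ?_)
      have h1 : (1 + K : X →L[ℂ] X) (n : X) = 0 := n.2
      rw [happ, hπ, h1, hn]
      simp
    · obtain ⟨x, hx⟩ := hb.2 c
      rw [happ] at hx
      refine ⟨π x, ?_⟩
      have h0 : (c - φ (π x) : X) = 0 :=
        hdisj x _ (C.sub_mem c.2 (φ (π x)).2) (eq_sub_of_add_eq hx)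
      exact Subtype.ext (sub_eq_zero.1 h0).symm
  refine ⟨⟨LinearMap.toContinuousLinearMap (C.subtype ∘ₗ φ) ∘L π, ?_, ?_⟩, ?_⟩
  · exact (LinearMap.HasFiniteRange.of_finite_dom (f := C.subtype ∘ₗ φ)).comp_right π.toLinearMap
  · rw [add_assoc, ContinuousLinearMap.isUnit_iff_bijective]
    exact hb
  · rw [LinearMap.index_eq_finrank_sub, (LinearEquiv.ofBijective φ hφ).finrank_eq,
      (Submodule.quotientEquivOfIsCompl _ _ hC).finrank_eq, sub_self]

end Fredholm

/-! ### Atkinson's theorem and stability of the index. -/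

section Atkinson

open LinearMap.FiniteRangeSetoid

variable {X : Type*} [NormedAddCommGroup X] [NormedSpace ℂ X]

theorem isCompactOperator_of_hasFiniteRange {S : X →L[ℂ] X}
    (h : S.toLinearMap.HasFiniteRange) : IsCompactOperator S := by
  have : FiniteDimensional ℂ S.range := Module.Finite.iff_fg.2 h
  have := FiniteDimensional.proper ℂ S.range
  have hc : IsCompactOperator (S.codRestrict S.range fun x => ⟨x, rfl⟩) :=
    isCompactOperator_of_locallyCompactSpace_dom _
  exact hc.clm_comp S.range.subtypeL

theorem exists_isCompactOperator_mul_sub_one {A : X →L[ℂ] X} (hA : A.IsFredholm) :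
    ∃ B : X →L[ℂ] X, IsCompactOperator (B * A - 1 : X →L[ℂ] X) ∧
      IsCompactOperator (A * B - 1 : X →L[ℂ] X) := by
  obtain ⟨B, hBA, hAB⟩ := hA.exists_isQuasiInverse
  exact ⟨B, isCompactOperator_of_hasFiniteRange (equiv_iff_hasFiniteRange.1 hBA),
    isCompactOperator_of_hasFiniteRange (equiv_iff_hasFiniteRange.1 hAB)⟩

theorem index_mul {A B : X →L[ℂ] X} (hA : A.IsFredholm) (hB : B.IsFredholm) :
    (A * B).toLinearMap.index = A.toLinearMap.index + B.toLinearMap.index := by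
  have := hA.finite_ker
  have := hB.finite_ker
  have : FiniteDimensional ℂ (X ⧸ A.range) := hA.finite_coker
  have : FiniteDimensional ℂ (X ⧸ B.range) := hB.finite_coker
  exact LinearMap.index_comp A.toLinearMap (f := B.toLinearMap)

variable [CompleteSpace X]

/-- Upgrades a compact error to a finite-rank one: S is a unit minus a finite-rank operator, and the
inverse of that unit serves as G. -/
theorem exists_mul_equiv_one {S : X →L[ℂ] X} (h : toCalkin X S = 1) :
    ∃ G : X →L[ℂ] X, (G * S - 1).toLinearMap.HasFiniteRange ∧
      (S * G - 1).toLinearMap.HasFiniteRange := by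
  rw [← map_one (toCalkin X), toCalkin_eq_iff] at h
  obtain ⟨⟨F, hF, u, hu⟩, -⟩ := exists_isUnit_one_add_add h
  rw [add_sub_cancel] at hu
  have hS : S = u - F := by rw [hu, add_sub_cancel_right]
  refine ⟨↑u⁻¹, ?_, ?_⟩
  · rw [hS, mul_sub, u.inv_mul, sub_sub_cancel_left]
    exact (hF.comp_left (↑u⁻¹ : X →L[ℂ] X).toLinearMap).neg
  · rw [hS, sub_mul, u.mul_inv, sub_sub_cancel_left]
    exact (hF.comp_right (↑u⁻¹ : X →L[ℂ] X).toLinearMap).neg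

/-- Atkinson's theorem: an operator invertible modulo the compact operators is Fredholm. -/
theorem isFredholm_of_isUnit_toCalkin {A : X →L[ℂ] X} (hA : IsUnit (toCalkin X A)) :
    A.IsFredholm := by
  obtain ⟨u, hu⟩ := hA
  obtain ⟨B, hB⟩ := Ideal.Quotient.mk_surjective (I := compactIdeal X) (↑u⁻¹)
  have hBA : toCalkin X (B * A) = 1 := by
    rw [map_mul, ← hu, hB, u.inv_mul]
  have hAB : toCalkin X (A * B) = 1 := by
    rw [map_mul, ← hu, hB, u.mul_inv]
  obtain ⟨G, hG, -⟩ := exists_mul_equiv_one hBA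
  obtain ⟨H, -, hH⟩ := exists_mul_equiv_one hAB
  rw [← mul_assoc] at hG
  rw [mul_assoc] at hH
  have hl : (G * B).toLinearMap ∘ₗ A.toLinearMap ≈ .id := equiv_iff_hasFiniteRange.2 hG
  have hr : A.toLinearMap ∘ₗ (B * H).toLinearMap ≈ .id := equiv_iff_hasFiniteRange.2 hH
  -- Left and right quasi-inverses agree modulo finite rank, as do one-sided inverses in a ring.
  have hlr : (G * B).toLinearMap ≈ (B * H).toLinearMap :=
    Setoid.trans (Setoid.symm (equiv_comp_left (u' := (G * B).toLinearMap) hr))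
      (equiv_comp_right (u := (B * H).toLinearMap) hl)
  exact .of_isQuasiInverse (v := G * B)
    ⟨hl, Setoid.trans (equiv_comp_left (u' := A.toLinearMap) hlr) hr⟩

theorem index_of_isUnit {A : X →L[ℂ] X} (hA : IsUnit A) : A.toLinearMap.index = 0 := by
  have hb := ContinuousLinearMap.isUnit_iff_bijective.1 hA
  exact LinearEquiv.index_eq_zero (e := LinearEquiv.ofBijective A.toLinearMap hb)

theorem index_of_toCalkin_eq_one {S : X →L[ℂ] X} (h : toCalkin X S = 1) :
    S.toLinearMap.index = 0 := by
  rw [← map_one (toCalkin X), toCalkin_eq_iff] at h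
  have := (exists_isUnit_one_add_add h).2
  rwa [add_sub_cancel] at this

/-- The index is invariant under compact perturbations. -/
theorem index_eq_of_toCalkin_eq {A A' : X →L[ℂ] X} (hA : IsUnit (toCalkin X A))
    (h : toCalkin X A = toCalkin X A') : A.toLinearMap.index = A'.toLinearMap.index := by
  obtain ⟨u, hu⟩ := id hA
  obtain ⟨B, hB⟩ := Ideal.Quotient.mk_surjective (I := compactIdeal X) (↑u⁻¹)
  have hBu : IsUnit (toCalkin X B) := by rw [toCalkin, hB]; exact u⁻¹.isUnit
  -- Both A and A' have index -ind B, since BA and BA' are compact perturbations of 1.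
  have h1 := index_of_toCalkin_eq_one (S := B * A) (by rw [map_mul, ← hu, hB, u.inv_mul])
  have h2 := index_of_toCalkin_eq_one (S := B * A') (by rw [map_mul, ← h, ← hu, hB, u.inv_mul])
  rw [index_mul (isFredholm_of_isUnit_toCalkin hBu) (isFredholm_of_isUnit_toCalkin hA)] at h1
  rw [index_mul (isFredholm_of_isUnit_toCalkin hBu) (isFredholm_of_isUnit_toCalkin (h ▸ hA))] at h2
  lia

/-- The index is locally constant on the set of Fredholm operators. -/
theorem eventually_index_eq {A : X →L[ℂ] X} (hA : IsUnit (toCalkin X A)) :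
    ∀ᶠ S in 𝓝 A, S.toLinearMap.index = A.toLinearMap.index := by
  obtain ⟨u, hu⟩ := id hA
  obtain ⟨B, hB⟩ := Ideal.Quotient.mk_surjective (I := compactIdeal X) (↑u⁻¹)
  have hBu : IsUnit (toCalkin X B) := by rw [toCalkin, hB]; exact u⁻¹.isUnit
  have hBA : toCalkin X (B * A) = 1 := by rw [map_mul, ← hu, hB, u.inv_mul]
  -- For S near A, 1 + B(S - A) is invertible and equals BS modulo compacts, so ind S = -ind B.
  have hcont : Tendsto (fun S : X →L[ℂ] X => 1 + B * (S - A)) (𝓝 A) (𝓝 (1 + B * (A - A))) :=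
    Continuous.tendsto (by fun_prop) A
  rw [sub_self, mul_zero, add_zero] at hcont
  filter_upwards [hcont (Units.isOpen.mem_nhds isUnit_one)] with S hS
  have hS' : IsUnit (1 + B * (S - A)) := hS
  have heq : toCalkin X (1 + B * (S - A)) = toCalkin X (B * S) := by
    rw [map_add, mul_sub, map_sub, hBA, map_one, add_sub_cancel]
  have hSu : IsUnit (toCalkin X S) := by
    have := hS'.map (toCalkin X)
    rw [heq, map_mul] at this
    obtain ⟨b, hb⟩ := hBu
    rw [← hb, Units.isUnit_units_mul] at this
    exact this
  have h1 := index_of_toCalkin_eq_one hBA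
  have h2 := index_eq_of_toCalkin_eq (hS'.map (toCalkin X)) heq
  rw [index_of_isUnit hS'] at h2
  rw [index_mul (isFredholm_of_isUnit_toCalkin hBu) (isFredholm_of_isUnit_toCalkin hA)] at h1
  rw [index_mul (isFredholm_of_isUnit_toCalkin hBu) (isFredholm_of_isUnit_toCalkin hSu)] at h2
  lia

/-- The index does not change along a segment of Fredholm operators. -/
theorem index_add_eq_of_segment {A E : X →L[ℂ] X}
    (h : ∀ s ∈ Set.Icc (0 : ℝ) 1, IsUnit (toCalkin X (A + (s : ℂ) • E))) :
    (A + E).toLinearMap.index = A.toLinearMap.index := by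
  let f : Set.Icc (0 : ℝ) 1 → ℤ := fun s => (A + ((s : ℝ) : ℂ) • E).toLinearMap.index
  have hf : IsLocallyConstant f := by
    refine (IsLocallyConstant.iff_eventually_eq f).2 fun s => ?_
    have hc : Continuous fun r : Set.Icc (0 : ℝ) 1 => A + ((r : ℝ) : ℂ) • E := by fun_prop
    exact (hc.tendsto s).eventually (eventually_index_eq (h s s.2))
  have := hf.apply_eq_of_isPreconnected (s := Set.univ) isPreconnected_univ
    (Set.mem_univ (1 : Set.Icc (0 : ℝ) 1)) (Set.mem_univ 0)
  simpa [f] using this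

end Atkinson

/-! ### Perturbation in a Banach algebra. -/

/-- Put g = (1 - p)(t + u) + p. Then gp = p, so t + u + p = g(1 + p(t + u)), a product of two units.
-/
theorem IsSpectralIdempotent.add {A : Type*} [NormedRing A] [NormedAlgebra ℂ A] [CompleteSpace A]
    {p t u : A} (h : IsSpectralIdempotent p t) (hpu : Commute p u)
    (hu : IsQuasinilpotent (p * u)) (hc : Commute (p * t) (p * u))
    (hg : IsUnit ((1 - p) * t + p + (1 - p) * u)) : IsSpectralIdempotent p (t + u) := by
  have hqn : IsQuasinilpotent (p * (t + u)) := by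
    rw [mul_add]
    exact h.isQuasinilpotent.add hu hc
  refine ⟨h.isIdempotentElem, h.commute.add_right hpu, hqn, ?_⟩
  have hp : p * p = p := h.isIdempotentElem
  have hz : ∀ x : A, Commute p x → (1 - p) * x * p = 0 := fun x hx => by
    rw [mul_assoc, ← hx.eq, ← mul_assoc, sub_mul, one_mul, hp, sub_self, zero_mul]
  have hgp : ((1 - p) * t + p + (1 - p) * u) * p = p := by
    rw [add_mul, add_mul, hz t h.commute, hz u hpu, hp, zero_add, add_zero]
  have hfac : t + u + p =
      ((1 - p) * t + p + (1 - p) * u) * (1 - (-1 : ℂ) • (p * (t + u))) := by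
    rw [neg_one_smul, sub_neg_eq_add, mul_add, ← mul_assoc _ p, hgp, mul_one]
    noncomm_ring
  rw [hfac]
  exact hg.mul (hqn.isUnit_one_sub_smul (-1))

/-- If `b - z⁻¹` is invertible in the corner of `p`, with inverse `v`, then `1 - z b` is
invertible. -/
theorem isUnit_one_sub_smul_of_corner_inverse {R : Type*} [Ring R] [Algebra ℂ R] {p b v : R}
    {z : ℂ} (hz : z ≠ 0) (hbp : b * p = b) (hpb : p * b = b) (hvb : v * b - z⁻¹ • v = p)
    (hbv : b * v - z⁻¹ • v = p) : IsUnit (1 - z • b) := by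
  have hl : v * b = p + z⁻¹ • v := sub_eq_iff_eq_add.1 hvb
  have hr : b * v = p + z⁻¹ • v := sub_eq_iff_eq_add.1 hbv
  -- On the corner of p, 1 - zb is -z(b - z⁻¹p), with inverse -z⁻¹v; on the other corner it is the
  -- identity.
  refine ⟨⟨1 - z • b, 1 - p - z⁻¹ • v, ?_, ?_⟩, rfl⟩
  · have h1 : (z • b) * (z⁻¹ • v) = b * v := by
      rw [smul_mul_smul_comm, mul_inv_cancel₀ hz, one_smul]
    have h2 : (z • b) * p = z • b := by rw [smul_mul_assoc, hbp]
    rw [sub_mul, one_mul, mul_sub, mul_sub, mul_one, h1, h2, hr]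
    abel
  · have h1 : (z⁻¹ • v) * (z • b) = v * b := by
      rw [smul_mul_smul_comm, inv_mul_cancel₀ hz, one_smul]
    have h2 : p * (z • b) = z • b := by rw [mul_smul_comm, hpb]
    rw [mul_sub, mul_one, sub_mul, sub_mul, one_mul, h1, h2, hl]
    abel

/-! ### Passage between operators on R(P) and corners of the Calkin algebra. -/

section Corner

variable {X : Type*} [NormedAddCommGroup X] [NormedSpace ℂ X]

/-- The extension of an operator on the range of `P` to the whole space, by composition with
`P`. -/
def cornerExtension (P : X →L[ℂ] X) (S : P.range →L[ℂ] P.range) : X →L[ℂ] X :=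
  P.range.subtypeL ∘L S ∘L P.codRestrict P.range fun x => ⟨x, rfl⟩

variable {P : X →L[ℂ] X}

theorem cornerExtension_sub (S R : P.range →L[ℂ] P.range) :
    cornerExtension P (S - R) = cornerExtension P S - cornerExtension P R := rfl

theorem cornerExtension_smul (z : ℂ) (S : P.range →L[ℂ] P.range) :
    cornerExtension P (z • S) = z • cornerExtension P S := rfl

theorem cornerExtension_one : cornerExtension P 1 = P := rfl

theorem isCompactOperator_cornerExtension {S : P.range →L[ℂ] P.range}
    (h : IsCompactOperator S) : IsCompactOperator (cornerExtension P S) :=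
  (h.comp_clm (P.codRestrict P.range fun x => ⟨x, rfl⟩)).clm_comp P.range.subtypeL

theorem norm_cornerExtension_le (S : P.range →L[ℂ] P.range) :
    ‖cornerExtension P S‖ ≤ ‖S‖ * ‖P‖ := by
  refine ContinuousLinearMap.opNorm_le_bound _ (by positivity) fun x => ?_
  calc ‖cornerExtension P S x‖ = ‖S ⟨P x, x, rfl⟩‖ := rfl
    _ ≤ ‖S‖ * ‖P x‖ := S.le_opNorm _
    _ ≤ ‖S‖ * (‖P‖ * ‖x‖) := by gcongr; exact P.le_opNorm x
    _ = ‖S‖ * ‖P‖ * ‖x‖ := (mul_assoc _ _ _).symm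

theorem apply_of_mem_range (hP : IsIdempotentElem P) (y : P.range) : P y = y := by
  obtain ⟨_, x, rfl⟩ := y
  exact congrArg (fun R : X →L[ℂ] X => R x) hP

/-- The extension is multiplicative, sends 1 to P and preserves compactness, so relations modulo
compacts on R(P) become relations in the corner of Π(P). -/
theorem cornerExtension_mul (hP : IsIdempotentElem P) (S R : P.range →L[ℂ] P.range) :
    cornerExtension P (S * R) = cornerExtension P S * cornerExtension P R := by
  ext x
  change (S (R ⟨P x, x, rfl⟩) : X) = S ⟨P (R ⟨P x, x, rfl⟩ : X), _, rfl⟩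
  congr 2
  exact Subtype.ext (apply_of_mem_range hP _).symm

theorem cornerExtension_mul_self (hP : IsIdempotentElem P) (S : P.range →L[ℂ] P.range) :
    cornerExtension P S * P = cornerExtension P S := by
  simpa only [mul_one, cornerExtension_one] using (cornerExtension_mul hP S 1).symm

theorem self_mul_cornerExtension (hP : IsIdempotentElem P) (S : P.range →L[ℂ] P.range) :
    P * cornerExtension P S = cornerExtension P S := by
  simpa only [one_mul, cornerExtension_one] using (cornerExtension_mul hP 1 S).symm

theorem cornerExtension_compression (hP : IsIdempotentElem P) (S : X →L[ℂ] X) :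
    cornerExtension P (compression P S) = P * S * P := by
  ext x
  change P (S (P (P x))) = P (S (P x))
  have : P (P x) = P x := apply_of_mem_range hP ⟨P x, x, rfl⟩
  rw [this]

theorem toCalkin_cornerExtension_compression (hP : IsIdempotentElem P) {S : X →L[ℂ] X}
    (h : Commute (toCalkin X P) (toCalkin X S)) :
    toCalkin X (cornerExtension P (compression P S)) = toCalkin X P * toCalkin X S := by
  rw [cornerExtension_compression hP, map_mul, map_mul, mul_assoc, ← h.eq, ← mul_assoc, ← map_mul,
    hP.eq]

theorem commute_toCalkin_of_compression (hP : IsIdempotentElem P) {T U : X →L[ℂ] X}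
    (hT : Commute (toCalkin X P) (toCalkin X T)) (hU : Commute (toCalkin X P) (toCalkin X U))
    (h : IsCompactOperator
      (compression P T * compression P U - compression P U * compression P T)) :
    Commute (toCalkin X P * toCalkin X T) (toCalkin X P * toCalkin X U) := by
  have := toCalkin_eq_zero_iff.2 (isCompactOperator_cornerExtension h)
  rw [cornerExtension_sub, cornerExtension_mul hP, cornerExtension_mul hP, map_sub, map_mul,
    map_mul, toCalkin_cornerExtension_compression hP hT,
    toCalkin_cornerExtension_compression hP hU, sub_eq_zero] at this
  exact this

theorem compression_smul (z : ℂ) (U : X →L[ℂ] X) :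
    compression P (z • U) = z • compression P U := by
  ext x
  change P ((z • U) (P x)) = z • P (U (P x))
  rw [smul_apply, map_smul]

theorem norm_compression_smul_le (z : ℂ) (U : X →L[ℂ] X) :
    ‖compression P (z • U)‖ ≤ ‖z‖ * ‖compression P U‖ := by
  rw [compression_smul]
  exact ContinuousLinearMap.opNorm_smul_le z _

variable [CompleteSpace X]

/-- For z ≠ 0, a quasi-inverse of U₁ - z⁻¹ extends to an inverse of pu - z⁻¹p in the corner of p. -/
theorem isQuasinilpotent_of_isRiesz_compression (hP : IsIdempotentElem P) {U : X →L[ℂ] X}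
    (hU : Commute (toCalkin X P) (toCalkin X U)) (h : IsRiesz (compression P U)) :
    IsQuasinilpotent (toCalkin X P * toCalkin X U) := by
  refine isQuasinilpotent_of_isUnit_one_sub_smul fun z => ?_
  rcases eq_or_ne z 0 with rfl | hz
  · simp
  obtain ⟨V, h1, h2⟩ := exists_isCompactOperator_mul_sub_one (h z⁻¹ (inv_ne_zero hz))
  replace h1 := toCalkin_eq_zero_iff.2 (isCompactOperator_cornerExtension h1)
  replace h2 := toCalkin_eq_zero_iff.2 (isCompactOperator_cornerExtension h2)
  rw [cornerExtension_sub, map_sub, cornerExtension_mul hP, map_mul, cornerExtension_sub, map_sub,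
    toCalkin_cornerExtension_compression hP hU, cornerExtension_smul, toCalkin_smul,
    cornerExtension_one, sub_eq_zero] at h1 h2
  have hpp : toCalkin X P * toCalkin X P = toCalkin X P := (hP.map (toCalkin X)).eq
  set p := toCalkin X P with hp
  set b := p * toCalkin X U with hb
  set v := toCalkin X (cornerExtension P V) with hv
  have hbp : b * p = b := by rw [hb, mul_assoc, ← hU.eq, ← mul_assoc, hpp]
  have hpb : p * b = b := by rw [hb, ← mul_assoc, hpp]
  have hvp : v * p = v := by
    rw [hv, hp, ← map_mul, cornerExtension_mul_self hP]
  have hpv : p * v = v := by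
    rw [hv, hp, ← map_mul, self_mul_cornerExtension hP]
  rw [mul_sub, mul_smul_comm, hvp] at h1
  rw [sub_mul, smul_mul_assoc, hpv] at h2
  exact isUnit_one_sub_smul_of_corner_inverse hz hbp hpb h1 h2

/-- The index of a pseudo B-Fredholm operator can be computed with any associated idempotent. -/
theorem IsAssociated.hasIndex {T : X →L[ℂ] X} (h : IsAssociated P T) :
    HasIndex T (T + P).toLinearMap.index := by
  refine ⟨⟨P, h⟩, fun Q hQ => ?_⟩
  have hQu : IsUnit (toCalkin X (T + Q)) := by rw [map_add]; exact hQ.isUnit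
  refine ⟨isFredholm_of_isUnit_toCalkin hQu, index_eq_of_toCalkin_eq hQu ?_⟩
  rw [map_add, map_add, hQ.isSpectralIdempotent.unique h.isSpectralIdempotent]

theorem IsAssociated.exists_forall_add {T : X →L[ℂ] X} (h : IsAssociated P T) :
    ∃ ε : ℝ, 0 < ε ∧ ∀ U : X →L[ℂ] X, Commute (toCalkin X P) (toCalkin X U) →
      IsQuasinilpotent (toCalkin X P * toCalkin X U) →
      Commute (toCalkin X P * toCalkin X T) (toCalkin X P * toCalkin X U) →
      ‖compression (1 - P) U‖ < ε → IsAssociated P (T + U) := by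
  obtain ⟨w, hw⟩ := h.isSpectralIdempotent.isUnit_one_sub_mul_add
  obtain ⟨W, hW⟩ := Ideal.Quotient.mk_surjective (I := compactIdeal X) (↑w⁻¹)
  have hpos : 0 < ‖W‖ * ‖1 - P‖ + 1 := by positivity
  -- W lifts the inverse of w = (1 - p)t + p. This ε gives ‖WV‖ < 1, so 1 + WV is invertible in
  -- L(X), and w times its image is w + (1 - p)u.
  refine ⟨(‖W‖ * ‖1 - P‖ + 1)⁻¹, inv_pos.2 hpos, fun U hU hqn hc hsmall => ?_⟩
  have hQ : IsIdempotentElem (1 - P) := h.isIdempotentElem.one_sub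
  have hQU : Commute (toCalkin X (1 - P)) (toCalkin X U) := by
    rw [map_sub, map_one]
    exact (Commute.one_left _).sub_left hU
  set V := cornerExtension (1 - P) (compression (1 - P) U) with hV
  have hVu : toCalkin X V = (1 - toCalkin X P) * toCalkin X U := by
    rw [hV, toCalkin_cornerExtension_compression hQ hQU, map_sub, map_one]
  have hnorm : ‖-(W * V)‖ < 1 := by
    rw [norm_neg]
    calc ‖W * V‖ ≤ ‖W‖ * (‖compression (1 - P) U‖ * ‖1 - P‖) :=
          (norm_mul_le _ _).trans (by gcongr; exact norm_cornerExtension_le _)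
      _ = ‖W‖ * ‖1 - P‖ * ‖compression (1 - P) U‖ := by ring
      _ ≤ ‖W‖ * ‖1 - P‖ * (‖W‖ * ‖1 - P‖ + 1)⁻¹ := by gcongr
      _ < (‖W‖ * ‖1 - P‖ + 1) * (‖W‖ * ‖1 - P‖ + 1)⁻¹ := by gcongr; linarith
      _ = 1 := mul_inv_cancel₀ hpos.ne'
  have hunit := (isUnit_one_sub_of_norm_lt_one hnorm).map (toCalkin X)
  rw [sub_neg_eq_add, map_add, map_one, map_mul, hW, hVu] at hunit
  have hs := h.isSpectralIdempotent.add hU hqn hc <| by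
    have := w.isUnit.mul hunit
    rwa [mul_add, mul_one, Units.mul_inv_cancel_left, hw] at this
  rw [← map_add] at hs
  exact ⟨h.isIdempotentElem, hs.commute, hs.isQuasinilpotent, hs.isUnit⟩

end Corner

end PseudoBFredholm

end
open PseudoBFredholm in
theorem theorem4p10 {X : Type*} [NormedAddCommGroup X] [NormedSpace ℂ X] [CompleteSpace X]
    (T P : X →L[ℂ] X) (hT : IsPseudoBFredholm T) (hP : IsAssociated P T) :
    ∃ ε : ℝ, 0 < ε ∧
      ∀ U : X →L[ℂ] X,
        Commute (toCalkin X P) (toCalkin X U) →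
        IsRiesz (compression P U) →
        IsCompactOperator
          (compression P T * compression P U - compression P U * compression P T) →
        ‖compression (1 - P) U‖ < ε →
          IsPseudoBFredholm (T + U) ∧ ∃ n : ℤ, HasIndex (T + U) n ∧ HasIndex T n := by
  obtain ⟨ε, hε, hadd⟩ := hP.exists_forall_add
  refine ⟨ε, hε, fun U hU hR hc hsmall => ?_⟩
  have hqn := isQuasinilpotent_of_isRiesz_compression hP.isIdempotentElem hU hR
  have hcomm := commute_toCalkin_of_compression hP.isIdempotentElem hP.commute hU hc
  -- Every condition on U survives scaling by s in [0, 1], so one ε serves the whole segment.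
  have hassoc : ∀ s ∈ Set.Icc (0 : ℝ) 1, IsAssociated P (T + (s : ℂ) • U) := fun s hs => by
    refine hadd _ ?_ ?_ ?_ ?_
    · rw [toCalkin_smul]
      exact hU.smul_right _
    · rw [toCalkin_smul, mul_smul_comm]
      exact hqn.smul _
    · rw [toCalkin_smul, mul_smul_comm]
      exact hcomm.smul_right _
    · refine (norm_compression_smul_le _ _).trans_lt ?_
      rw [Complex.norm_real, Real.norm_of_nonneg hs.1]
      exact (mul_le_of_le_one_left (ContinuousLinearMap.opNorm_nonneg _) hs.2).trans_lt hsmall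
  have h1 : IsAssociated P (T + U) := by
    simpa using hassoc 1 (Set.right_mem_Icc.2 zero_le_one)
  have hind : (T + U + P).toLinearMap.index = (T + P).toLinearMap.index := by
    rw [add_right_comm]
    refine index_add_eq_of_segment fun s hs => ?_
    rw [add_right_comm, map_add]
    exact (hassoc s hs).isUnit
  exact ⟨⟨P, h1⟩, _, h1.hasIndex, hind ▸ hP.hasIndex⟩
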